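/- **Theorem 8.13.** Let $n\ge 2$ be an integer and $r\in(0,+\infty]$. Put $\mathbb{C}^\times=\mathbb{C}\setminus\{0\}$ and $\mathbb{D}_r=\{w\in\mathbb{C}:|w|<r\}$. All algebras are unital over $\mathbb{C}$, and spaces of holomorphic functions carry the compact-open topology. Let $$\mathcal{F}(\mathbb{D}_r^n)=\mathcal{O}(\mathbb{D}_r)\,\widehat{*}\cdots\widehat{*}\,\mathcal{O}(\mathbb{D}_r)\qquad(n\text{ factors})$$ be the analytic free product, i.e. the coproduct in the category of Arens–Michael algebras (complete Hausdorff topological algebras whose topology is defined by submultiplicative seminorms), and let $\zeta_i\in\mathcal{F}(\mathbb{D}_r^n)$ be the image of the complex coordinate of the $i$-th factor. Let $\mathcal{O}(\mathbb{C}^\times,\mathcal{F}(\mathbb{D}_r^n))$ be the algebra of holomorphic $\mathcal{F}(\mathbb{D}_r^n)$-valued functions on $\mathbb{C}^\times$, let $z\in\mathcal{O}(\mathbb{C}^\times)$ be the complex coordinate, let $I$ be the closed two-sided ideal of $\mathcal{O}(\mathbb{C}^\times,\mathcal{F}(\mathbb{D}_r^n))$ generated by the elements $\zeta_i\zeta_j-z\,\zeta_j\zeta_i$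 $(1\le i<j\le n)$, and put $$\mathcal{O}_{\mathrm{def}}(\mathbb{D}_r^n)=\mathcal{O}(\mathbb{C}^\times,\mathcal{F}(\mathbb{D}_r^n))/I$$ with the quotient topology and the natural action of $\mathcal{O}(\mathbb{C}^\times)$ by multiplication. Then $\mathcal{O}_{\mathrm{def}}(\mathbb{D}_r^n)$ is a Fréchet $\mathcal{O}(\mathbb{C}^\times)$-module which is not topologically projective, and hence is not topologically free. Here, for a Fréchet algebra $A$, a Fréchet $A$-module is a left $A$-module with a Fréchet space topology such that the action $A\times X\to X$ is continuous; morphisms are continuous $A$-linear maps. A Fréchet $A$-module $P$ is topologically projective if, for every morphism $\sigma:X\to Y$ of Fréchet $A$-modules that admits a continuous $\mathbb{C}$-linear right inverse, every morphism $P\to Y$ lifts along $\sigma$ to a morphism $P\to X$. It is topologically free if $P\cong A\,\widehat{\otimes}\,E$ for some Fréchet space $E$, where $\widehat{\otimes}$ is the completed projective tensor product, with the action $a(b\otimes e)=ab\otimes e$. -/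

import Mathlib

open scoped Topology ENNReal

noncomputable section

namespace HolDef

universe u

/-! ## Complete locally convex spaces, Fréchet spaces, Fréchet modules -/

/-- Complete Hausdorff locally convex spaces over `ℂ`. -/
structure IsCompleteLCS (E : Type u) [AddCommGroup E] [Module ℂ E] [TopologicalSpace E] :
    Prop where
  isTopologicalAddGroup : IsTopologicalAddGroup E
  polynormable : PolynormableSpace ℂ E
  t2 : T2Space E
  complete : @CompleteSpace E (@IsTopologicalAddGroup.rightUniformSpace E _ _ isTopologicalAddGroup)

/-- Fréchet spaces over `ℂ`: complete metrizable locally convex spaces. -/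
structure IsFrechetSpace (E : Type u) [AddCommGroup E] [Module ℂ E] [TopologicalSpace E] : Prop
    extends IsCompleteLCS E where
  metrizable : TopologicalSpace.MetrizableSpace E

/-- Left Fréchet modules over a topological algebra `A`: the underlying space is a Fréchet space
and the action `A × X → X` is jointly continuous. -/
structure IsFrechetModule (A : Type u) [Ring A] [Algebra ℂ A] [TopologicalSpace A]
    (X : Type u) [AddCommGroup X] [Module ℂ X] [Module A X] [IsScalarTower ℂ A X]
    [TopologicalSpace X] : Prop extends IsFrechetSpace X where
  continuous_action : Continuous fun q : A × X => q.1 • q.2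

section Modules

variable (A : Type u) [Ring A] [Algebra ℂ A] [TopologicalSpace A]

/-- A morphism `σ : X → Y` of topological modules is an admissible epimorphism if it has a
continuous `ℂ`-linear right inverse. -/
def IsAdmissibleEpi {A : Type u} [Ring A]
    {X Y : Type u} [AddCommGroup X] [Module ℂ X] [Module A X] [TopologicalSpace X]
    [AddCommGroup Y] [Module ℂ Y] [Module A Y] [TopologicalSpace Y] (σ : X →L[A] Y) : Prop :=
  ∃ κ : Y →L[ℂ] X, ∀ y, σ (κ y) = y

/-- Topological projectivity of a Fréchet `A`-module `P`: for every admissible epimorphism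
`X → Y` of Fréchet `A`-modules, the map `Hom_A(P, X) → Hom_A(P, Y)` is onto. -/
def IsTopProjective (P : Type u) [AddCommGroup P] [Module A P] [TopologicalSpace P] : Prop :=
  ∀ (X Y : Type u)
    [AddCommGroup X] [Module ℂ X] [Module A X] [IsScalarTower ℂ A X] [TopologicalSpace X]
    [AddCommGroup Y] [Module ℂ Y] [Module A Y] [IsScalarTower ℂ A Y] [TopologicalSpace Y],
    IsFrechetModule A X → IsFrechetModule A Y →
      ∀ σ : X →L[A] Y, IsAdmissibleEpi σ →
        ∀ φ : P →L[A] Y, ∃ ψ : P →L[A] X, σ.comp ψ = φ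

end Modules

/-- `β : V × E → T` exhibits `T` as the completed projective tensor product `V ⊗̂ E`:
`T` is a complete locally convex space, `β` is a jointly continuous bilinear map, and every jointly
continuous bilinear map from `V × E` to a complete locally convex space factors uniquely through
`β` by a continuous linear map. -/
structure IsCompletedProjTensor {V E T : Type u}
    [AddCommGroup V] [Module ℂ V] [TopologicalSpace V]
    [AddCommGroup E] [Module ℂ E] [TopologicalSpace E]
    [AddCommGroup T] [Module ℂ T] [TopologicalSpace T] (β : V →ₗ[ℂ] E →ₗ[ℂ] T) : Prop where
  complete : IsCompleteLCS T
  continuous : Continuous fun q : V × E => β q.1 q.2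
  existsUnique_lift : ∀ (G : Type u) [AddCommGroup G] [Module ℂ G] [TopologicalSpace G],
    IsCompleteLCS G → ∀ b : V →ₗ[ℂ] E →ₗ[ℂ] G, (Continuous fun q : V × E => b q.1 q.2) →
      ∃! f : T →L[ℂ] G, ∀ v e, f (β v e) = b v e

/-- Topological freeness: `P ≅ A ⊗̂ E` for a Fréchet space `E`, where `A` acts on `A ⊗̂ E` by
`a • (b ⊗ e) = (a * b) ⊗ e`. -/
def IsTopFree (A : Type u) [Ring A] [Algebra ℂ A] [TopologicalSpace A]
    (P : Type u) [AddCommGroup P] [Module ℂ P] [Module A P] [TopologicalSpace P] : Prop :=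
  ∃ (E : Type u) (_ : AddCommGroup E) (_ : Module ℂ E) (_ : TopologicalSpace E),
    IsFrechetSpace E ∧ ∃ β : A →ₗ[ℂ] E →ₗ[ℂ] P,
      IsCompletedProjTensor β ∧ ∀ (a b : A) (e : E), β (a * b) e = a • β b e

/-! ## Algebras of vector-valued holomorphic functions -/

section Holomorphic

variable (U : TopologicalSpace.Opens ℂ) (F : Type u) [Ring F] [Algebra ℂ F] [TopologicalSpace F]

variable {U F} in
/-- A function on an open subset of `ℂ` with values in a topological vector space is holomorphic
if its difference quotients converge at every point. -/
def IsHolomorphic (f : U → F) : Prop :=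
  ∀ x : U, ∃ d : F,
    Filter.Tendsto (fun y : U => ((y : ℂ) - (x : ℂ))⁻¹ • (f y - f x)) (𝓝[≠] x) (𝓝 d)

variable [IsTopologicalRing F]

/-- The algebra `𝒪(U, F)` of holomorphic functions on `U` with values in a topological algebra
`F`, as a subalgebra of `C(U, F)`; its topology is the compact-open one. -/
def holSubalgebra : Subalgebra ℂ C(U, F) where
  carrier := {f | IsHolomorphic f}
  mul_mem' := by
    intro f g hf hg x
    obtain ⟨a, ha⟩ := hf x
    obtain ⟨b, hb⟩ := hg x
    have hg' : Filter.Tendsto (fun y : U => g y) (𝓝[≠] x) (𝓝 (g x)) :=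
      (g.continuous.tendsto x).mono_left nhdsWithin_le_nhds
    refine ⟨a * g x + f x * b, ((ha.mul hg').add (hb.const_mul (f x))).congr fun y => ?_⟩
    simp only [ContinuousMap.mul_apply, smul_mul_assoc, mul_smul_comm, ← smul_add]
    congr 1
    noncomm_ring
  add_mem' := by
    intro f g hf hg x
    obtain ⟨a, ha⟩ := hf x
    obtain ⟨b, hb⟩ := hg x
    refine ⟨a + b, (ha.add hb).congr fun y => ?_⟩
    simp only [ContinuousMap.add_apply, ← smul_add]
    congr 1
    abel
  algebraMap_mem' := by
    intro c x
    refine ⟨0, (tendsto_const_nhds (x := (0 : F))).congr fun y => ?_⟩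
    simp [Algebra.algebraMap_eq_smul_one]

/-- The topological algebra `𝒪(U, F)`. -/
abbrev Hol : Type u := holSubalgebra U F

instance : IsTopologicalRing (Hol U F) :=
  haveI : LocallyCompactSpace U := U.isOpen.locallyCompactSpace
  inferInstanceAs (IsTopologicalRing (holSubalgebra U F).toSubring)

instance : IsTopologicalAddGroup (Hol U F) := IsTopologicalRing.to_topologicalAddGroup

/-- The coordinate function, as an element of `𝒪(U) = 𝒪(U, ℂ)`. -/
def coord : Hol U ℂ :=
  ⟨⟨fun x => (x : ℂ), continuous_subtype_val⟩, fun x => by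
    refine ⟨1, (tendsto_const_nhds (x := (1 : ℂ))).congr' ?_⟩
    filter_upwards [self_mem_nhdsWithin] with y hy
    have : (y : ℂ) - (x : ℂ) ≠ 0 := sub_ne_zero.2 fun h => hy (Subtype.ext h)
    simp [this]⟩

variable {F} in
/-- The constant function with value `a`, i.e. the element `1 ⊗ a` of `𝒪(U, F)`. -/
def constHol (a : F) : Hol U F :=
  ⟨ContinuousMap.const U a, fun x => ⟨0, by simpa using tendsto_const_nhds⟩⟩

variable [ContinuousSMul ℂ F]

/-- The embedding `f ↦ f ⊗ 1` of `𝒪(U)` into `𝒪(U, F)`, that is, `(f ⊗ 1)(x) = f(x) 1`. -/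
def scalarHol : Hol U ℂ →+* Hol U F where
  toFun f := ⟨⟨fun x => algebraMap ℂ F (f.1 x),
      (continuous_algebraMap ℂ F).comp f.1.continuous⟩, fun x => by
    obtain ⟨d, hd⟩ := f.2 x
    refine ⟨algebraMap ℂ F d,
      (((continuous_algebraMap ℂ F).tendsto d).comp hd).congr fun y => ?_⟩
    simp [Algebra.smul_def]⟩
  map_one' := by ext x; simp
  map_mul' f g := by ext x; simp
  map_zero' := by ext x; simp
  map_add' f g := by ext x; simp

/-- `𝒪(U, F)` as an `𝒪(U)`-algebra, with action `(f • g)(x) = f(x) g(x)`. -/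
@[reducible] def holAlgebra : Algebra (Hol U ℂ) (Hol U F) :=
  (scalarHol U F).toAlgebra' fun f g => by
    ext x
    exact Algebra.commutes (f.1 x) (g.1 x)

end Holomorphic

/-! ## Analytic free products -/

section FreeProduct

variable {I : Type u} [DecidableEq I] (A : I → Type u)
  [∀ i, Ring (A i)] [∀ i, Algebra ℂ (A i)] [∀ i, TopologicalSpace (A i)]

/-- The algebraic free product (coproduct of unital `ℂ`-algebras) of the `A i`. -/
def AlgFreeProduct : Type u := LinearAlgebra.FreeProduct ℂ A

instance : Ring (AlgFreeProduct A) :=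
  inferInstanceAs (Ring (LinearAlgebra.FreeProduct.ringCon ℂ A).Quotient)

instance : Algebra ℂ (AlgFreeProduct A) :=
  inferInstanceAs (Algebra ℂ (LinearAlgebra.FreeProduct.ringCon ℂ A).Quotient)

/-- The canonical homomorphisms into the algebraic free product. -/
def algIncl (i : I) : A i →ₐ[ℂ] AlgFreeProduct A := LinearAlgebra.FreeProduct.ι ℂ A i

/-- The submultiplicative seminorms on the algebraic free product whose restrictions to all the
factors are continuous. -/
def FreeSeminorm : Type u :=
  {p : Seminorm ℂ (AlgFreeProduct A) //
    (∀ a b, p (a * b) ≤ p a * p b) ∧ ∀ i, Continuous fun a : A i => p (algIncl A i a)}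

/-- The family of all these seminorms. -/
def freeSeminorms : SeminormFamily ℂ (AlgFreeProduct A) (FreeSeminorm A) := fun p => p.1

/-- The algebraic free product carries the locally `m`-convex topology defined by all of them. -/
instance : TopologicalSpace (AlgFreeProduct A) := (freeSeminorms A).moduleFilterBasis.topology

theorem withSeminorms_freeSeminorms : WithSeminorms (freeSeminorms A) := ⟨rfl⟩

instance : IsTopologicalAddGroup (AlgFreeProduct A) :=
  (withSeminorms_freeSeminorms A).topologicalAddGroup

instance : ContinuousSMul ℂ (AlgFreeProduct A) :=
  (withSeminorms_freeSeminorms A).continuousSMul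

instance : IsTopologicalRing (AlgFreeProduct A) := by
  have hw := withSeminorms_freeSeminorms A
  have hc : ∀ p : FreeSeminorm A, Filter.Tendsto (fun x => p.1 x) (𝓝 0) (𝓝 0) := fun p => by
    have h : Filter.Tendsto (fun x => p.1 x) (𝓝 0) (𝓝 (p.1 0)) :=
      (hw.continuous_seminorm p).tendsto 0
    rwa [map_zero] at h
  have key : ∀ {X : Type u} (l : Filter X) (f g : X → AlgFreeProduct A),
      (∀ p : FreeSeminorm A, Filter.Tendsto (fun x => p.1 (f x) * p.1 (g x)) l (𝓝 0)) →
      Filter.Tendsto (fun x => f x * g x) l (𝓝 0) := by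
    intro X l f g h
    rw [hw.tendsto_nhds]
    intro p ε hε
    filter_upwards [(h p).eventually_lt_const hε] with x hx
    rw [sub_zero]
    exact (p.2.1 _ _).trans_lt hx
  refine IsTopologicalRing.of_addGroup_of_nhds_zero ?_ (fun a => ?_) (fun a => ?_)
  · refine key (𝓝 0 ×ˢ 𝓝 0) Prod.fst Prod.snd fun p => ?_
    simpa using ((hc p).comp Filter.tendsto_fst).mul ((hc p).comp Filter.tendsto_snd)
  · refine key (𝓝 0) (fun _ => a) id fun p => ?_
    simpa using (hc p).const_mul (p.1 a)
  · refine key (𝓝 0) id (fun _ => a) fun p => ?_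
    simpa using (hc p).mul_const (p.1 a)

instance : UniformSpace (AlgFreeProduct A) :=
  IsTopologicalAddGroup.rightUniformSpace (AlgFreeProduct A)

instance : IsUniformAddGroup (AlgFreeProduct A) := isUniformAddGroup_of_addCommGroup

instance : UniformContinuousConstSMul ℂ (AlgFreeProduct A) :=
  uniformContinuousConstSMul_of_continuousConstSMul ℂ (AlgFreeProduct A)

/-- The analytic free product `A₁ *̂ ⋯ *̂ Aₙ`, i.e. the coproduct in the category of Arens-Michael
algebras, as the (Hausdorff) completion of the algebraic free product in the finest locally
`m`-convex topology making all the canonical homomorphisms continuous. -/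
def AnalyticFreeProduct : Type u := UniformSpace.Completion (AlgFreeProduct A)

instance : Ring (AnalyticFreeProduct A) :=
  inferInstanceAs (Ring (UniformSpace.Completion (AlgFreeProduct A)))

instance : Algebra ℂ (AnalyticFreeProduct A) :=
  inferInstanceAs (Algebra ℂ (UniformSpace.Completion (AlgFreeProduct A)))

instance : UniformSpace (AnalyticFreeProduct A) :=
  inferInstanceAs (UniformSpace (UniformSpace.Completion (AlgFreeProduct A)))

instance : IsUniformAddGroup (AnalyticFreeProduct A) :=
  inferInstanceAs (IsUniformAddGroup (UniformSpace.Completion (AlgFreeProduct A)))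

instance : IsTopologicalRing (AnalyticFreeProduct A) :=
  inferInstanceAs (IsTopologicalRing (UniformSpace.Completion (AlgFreeProduct A)))

instance : ContinuousSMul ℂ (AnalyticFreeProduct A) :=
  continuousSMul_of_algebraMap ℂ (AnalyticFreeProduct A)
    ((UniformSpace.Completion.continuous_coe (AlgFreeProduct A)).comp
      (continuous_algebraMap ℂ (AlgFreeProduct A)))

/-- The canonical map of the `i`-th factor to the analytic free product. -/
def incl (i : I) (a : A i) : AnalyticFreeProduct A :=
  (algIncl A i a : UniformSpace.Completion (AlgFreeProduct A))

end FreeProduct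

/-! ## The deformation of the algebra of holomorphic functions on the polydisk -/

/-- The closed two-sided ideal generated by a subset of a topological ring. -/
def closedIdealSpan {R : Type u} [Ring R] [TopologicalSpace R] (S : Set R) : Ideal R :=
  sInf {I : Ideal R | I.IsTwoSided ∧ IsClosed (I : Set R) ∧ S ⊆ I}

instance {R : Type u} [Ring R] [TopologicalSpace R] (S : Set R) :
    (closedIdealSpan S).IsTwoSided where
  mul_mem_of_left := by
    intro a b ha
    rw [closedIdealSpan, Submodule.mem_sInf] at ha ⊢
    exact fun I hI => hI.1.mul_mem_of_left b (ha I hI)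

/-- The open disk `𝔻_r` of radius `r ∈ (0, ∞]`. -/
def disk (r : ℝ≥0∞) : TopologicalSpace.Opens ℂ :=
  ⟨{z | ENNReal.ofReal ‖z‖ < r},
    isOpen_lt (ENNReal.continuous_ofReal.comp continuous_norm) continuous_const⟩

/-- The punctured plane `ℂ^× = ℂ \ {0}`. -/
def puncturedPlane : TopologicalSpace.Opens ℂ := ⟨{z | z ≠ 0}, isOpen_ne⟩

/-- The Fréchet algebra `𝒪(ℂ^×)`. -/
abbrev HolCx : Type := Hol puncturedPlane ℂ

/-- The algebra `ℱ(𝔻_r^n) = 𝒪(𝔻_r) *̂ ⋯ *̂ 𝒪(𝔻_r)` (`n` factors) of holomorphic functions on the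
free polydisk. -/
abbrev FreePolydisk (n : ℕ) (r : ℝ≥0∞) : Type :=
  AnalyticFreeProduct fun _ : Fin n => Hol (disk r) ℂ

/-- The image `ζ_i` in `ℱ(𝔻_r^n)` of the coordinate on the `i`-th disk. -/
def zeta (n : ℕ) (r : ℝ≥0∞) (i : Fin n) : FreePolydisk n r :=
  incl (fun _ : Fin n => Hol (disk r) ℂ) i (coord (disk r))

/-- The element `ζ_i ζ_j - z ζ_j ζ_i` of `𝒪(ℂ^×, ℱ(𝔻_r^n))`. -/
def relator (n : ℕ) (r : ℝ≥0∞) (i j : Fin n) : Hol puncturedPlane (FreePolydisk n r) :=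
  constHol puncturedPlane (zeta n r i * zeta n r j) -
    scalarHol puncturedPlane (FreePolydisk n r) (coord puncturedPlane) *
      constHol puncturedPlane (zeta n r j * zeta n r i)

/-- The closed two-sided ideal of `𝒪(ℂ^×, ℱ(𝔻_r^n))` generated by the `ζ_i ζ_j - z ζ_j ζ_i`,
`i < j`. -/
def defIdeal (n : ℕ) (r : ℝ≥0∞) : Ideal (Hol puncturedPlane (FreePolydisk n r)) :=
  closedIdealSpan {a | ∃ i j : Fin n, i < j ∧ a = relator n r i j}

instance (n : ℕ) (r : ℝ≥0∞) : (defIdeal n r).IsTwoSided :=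
  inferInstanceAs (closedIdealSpan _).IsTwoSided

/-- The algebra `𝒪_def(𝔻_r^n)`: the quotient of `𝒪(ℂ^×, ℱ(𝔻_r^n))` by `defIdeal n r`, with the
quotient topology. -/
def ODef (n : ℕ) (r : ℝ≥0∞) : Type := Hol puncturedPlane (FreePolydisk n r) ⧸ defIdeal n r

instance (n : ℕ) (r : ℝ≥0∞) : Ring (ODef n r) :=
  inferInstanceAs (Ring (Hol puncturedPlane (FreePolydisk n r) ⧸ defIdeal n r))

instance (n : ℕ) (r : ℝ≥0∞) : TopologicalSpace (ODef n r) :=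
  QuotientModule.Quotient.topologicalSpace (defIdeal n r)

instance (n : ℕ) (r : ℝ≥0∞) : Algebra ℂ (ODef n r) :=
  inferInstanceAs (Algebra ℂ (Hol puncturedPlane (FreePolydisk n r) ⧸ defIdeal n r))

/-- The `𝒪(ℂ^×)`-algebra structure of `𝒪_def(𝔻_r^n)`. -/
instance (n : ℕ) (r : ℝ≥0∞) : Algebra HolCx (ODef n r) :=
  letI := holAlgebra puncturedPlane (FreePolydisk n r)
  inferInstanceAs (Algebra HolCx (Hol puncturedPlane (FreePolydisk n r) ⧸ defIdeal n r))

instance (n : ℕ) (r : ℝ≥0∞) : IsScalarTower ℂ HolCx (ODef n r) :=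
  IsScalarTower.of_algebraMap_eq fun _ => rfl

end HolDef

end

open scoped Topology ENNReal

noncomputable section

namespace HolDef

universe u

open Filter Set
open scoped Uniformity

/-! ### Permanence of local convexity, and local Banach spaces -/

section LocallyConvex

variable {E F : Type*} [AddCommGroup E] [Module ℂ E] [TopologicalSpace E]
  [AddCommGroup F] [Module ℂ F] [TopologicalSpace F]

/-! Non-projectivity comes from the impossibility of extending a fibre functional over `z = 1` to a
module map. At `z = 1` the relators become commutators, so a diagonal point `(q, ..., q)` with `0 <
q < r` gives a character `oDefCharacter` of `ODef n r`, a morphism onto the module `ℂ` where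
`𝒪(ℂ^×)` acts through evaluation at `1`. Evaluation `𝒪(ℂ^×) → ℂ` is split by constants, so
projectivity would give a morphism `ψ : ODef n r → 𝒪(ℂ^×)` with `ψ(p)(1)` equal to the character of
`p`.

Let `x = ζ_i`, `y = ζ_j`, `i < j`. The relation gives `x^(2k) y^(2k) = z^(4k²) y^(2k) x^(2k)`, hence
`h = z^(4k²) g` for the images `h`, `g` of the two products under `ψ`. By continuity of `ψ` and
submultiplicativity of the seminorms, both are at most `C B^(4k)` on `1/2 ≤ |z| ≤ 2`
(`exists_pow_bound`). The intermediate function `z^(2k²) g` gains a factor `2^(-2k²)` on each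
boundary circle: on the inner one compare it with `g`, on the outer one with `h`. The maximum
principle (`norm_apply_one_le`) yields `|h(1)| ≤ C B^(4k) / 2^(2k²)`, whereas `h(1) = q^(4k)`: a
contradiction for large `k` (`not_forall_pow_le`).

The Fréchet property passes through free product, holomorphic functions and quotient. Its delicate
point is metrizability of the free product, where countably many maximal seminorms suffice
(`maxFreeSeminorm`). Freeness is excluded because free modules are projective
(`IsTopFree.isTopProjective`). -/

open scoped ComplexOrder in
theorem polynormableSpace_of_locallyConvexSpace [IsTopologicalAddGroup E] [ContinuousSMul ℂ E]
    [h : LocallyConvexSpace ℝ E] : PolynormableSpace ℂ E := by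
  have : ContinuousSMul ℝ E := IsScalarTower.continuousSMul ℂ
  have : LocallyConvexSpace ℂ E := by
    rw [locallyConvexSpace_iff_exists_convex_subset] at h ⊢
    intro x U hU
    obtain ⟨S, hS, hc, hSU⟩ := h x U hU
    -- In the order on `ℂ` the nonnegative scalars are exactly the nonnegative reals, so real and
    -- complex convexity agree.
    exact ⟨S, hS, convex_of_nonneg_surjective_algebraMap (A := ℂ)
      (fun _ ha => RCLike.nonneg_iff_exists_ofReal.mp (mem_Ici.1 ha)) hc, hSU⟩
  infer_instance

theorem locallyConvexSpace_of_polynormableSpace [h : PolynormableSpace ℂ E] :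
    LocallyConvexSpace ℝ E :=
  (PolynormableSpace.withSeminorms ℂ E).toLocallyConvexSpace

theorem polynormableSpace_of_isOpenQuotientMap [PolynormableSpace ℂ E]
    [IsTopologicalAddGroup F] [ContinuousSMul ℂ F] (f : E →ₗ[ℂ] F) (hf : IsOpenQuotientMap f) :
    PolynormableSpace ℂ F := by
  have := (PolynormableSpace.withSeminorms ℂ E).topologicalAddGroup
  have hE : LocallyConvexSpace ℝ E := locallyConvexSpace_of_polynormableSpace
  rw [locallyConvexSpace_iff_exists_convex_subset_zero] at hE
  have : ContinuousSMul ℝ F := IsScalarTower.continuousSMul ℂ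
  have : LocallyConvexSpace ℝ F := by
    rw [locallyConvexSpace_iff_exists_convex_subset_zero]
    intro U hU
    obtain ⟨S, hS, hc, hSU⟩ := hE (f ⁻¹' U)
      (hf.continuous.continuousAt (by simpa using hU))
    refine ⟨f '' S, by simpa using hf.isOpenMap.image_mem_nhds hS, ?_, by simpa using hSU⟩
    exact hc.linear_image (f.restrictScalars ℝ)
  exact polynormableSpace_of_locallyConvexSpace

/-- By regularity a neighbourhood of `0` may be shrunk to a closed one; the closure of the image of
a convex neighbourhood is then convex, lies inside it, and is a neighbourhood by density. -/
theorem polynormableSpace_of_isDenseInducing [PolynormableSpace ℂ E]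
    [IsTopologicalAddGroup F] [ContinuousSMul ℂ F] (f : E →ₗ[ℂ] F) (hf : IsDenseInducing f) :
    PolynormableSpace ℂ F := by
  have := (PolynormableSpace.withSeminorms ℂ E).topologicalAddGroup
  have hE : LocallyConvexSpace ℝ E := locallyConvexSpace_of_polynormableSpace
  rw [locallyConvexSpace_iff_exists_convex_subset_zero] at hE
  have : ContinuousSMul ℝ F := IsScalarTower.continuousSMul ℂ
  have : LocallyConvexSpace ℝ F := by
    rw [locallyConvexSpace_iff_exists_convex_subset_zero]
    intro U hU
    obtain ⟨V, hV, hVc, hVU⟩ := exists_mem_nhds_isClosed_subset hU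
    obtain ⟨S, hS, hc, hSU⟩ := hE (f ⁻¹' V)
      (hf.continuous.continuousAt (by simpa using hV))
    refine ⟨closure (f '' S), by simpa using hf.closure_image_mem_nhds hS, ?_,
      (closure_minimal (by simpa using hSU) hVc).trans hVU⟩
    exact (hc.linear_image (f.restrictScalars ℝ)).closure
  exact polynormableSpace_of_locallyConvexSpace

/-- The space `E` with the topology defined by the seminorm `p`. -/
def SeminormSpace {E : Type u} [AddCommGroup E] [Module ℂ E] (_ : Seminorm ℂ E) : Type u := E

instance {E : Type u} [AddCommGroup E] [Module ℂ E] (p : Seminorm ℂ E) :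
    SeminormedAddCommGroup (SeminormSpace p) :=
  p.toSeminormedAddCommGroup

instance {E : Type u} [AddCommGroup E] [Module ℂ E] (p : Seminorm ℂ E) :
    NormedSpace ℂ (SeminormSpace p) :=
  letI : Module ℂ (SeminormSpace p) := inferInstanceAs (Module ℂ E)
  { norm_smul_le := fun a b ↦ le_of_eq (map_smul_eq_mul p a b) }

/-- A continuous seminorm is the pullback of the norm of a Banach space. -/
theorem exists_banach_of_seminorm {E : Type u} [AddCommGroup E] [Module ℂ E] [TopologicalSpace E]
    [IsTopologicalAddGroup E] (p : Seminorm ℂ E) (hp : Continuous p) :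
    ∃ (B : Type u) (_ : NormedAddCommGroup B) (_ : NormedSpace ℂ B) (_ : CompleteSpace B)
      (g : E →L[ℂ] B), ∀ x, ‖g x‖ = p x := by
  let i : E →ₗ[ℂ] SeminormSpace p :=
    { toFun := fun x => x, map_add' := fun _ _ => rfl, map_smul' := fun _ _ => rfl }
  have hi : Continuous i := by
    refine continuous_of_continuousAt_zero i.toAddMonoidHom ?_
    rw [ContinuousAt, map_zero]
    refine tendsto_zero_iff_norm_tendsto_zero.2 ?_
    have := hp.tendsto 0
    rwa [map_zero] at this
  exact ⟨UniformSpace.Completion (SeminormSpace p), inferInstance, inferInstance, inferInstance,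
    UniformSpace.Completion.toComplL.comp ⟨i, hi⟩, fun x => UniformSpace.Completion.norm_coe _⟩

end LocallyConvex

/-! ### Vector-valued holomorphy and its stability under limits -/

section HolClosed

variable {U : TopologicalSpace.Opens ℂ}

/-- The extension by zero of a function on an open subset of `ℂ`. -/
def extendZero {B : Type*} [Zero B] (f : U → B) : ℂ → B := Function.extend Subtype.val f 0

theorem extendZero_apply {B : Type*} [Zero B] (f : U → B) (x : U) : extendZero f x = f x :=
  Subtype.val_injective.extend_apply _ _ _

theorem map_val_nhdsNE (x : U) : map ((↑) : U → ℂ) (𝓝[≠] x) = 𝓝[≠] (x : ℂ) := by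
  have h := U.isOpen.isOpenEmbedding_subtypeVal
  have h1 : ({x}ᶜ : Set U) = (↑) ⁻¹' ({(x : ℂ)}ᶜ : Set ℂ) := by
    ext y; simp only [mem_compl_iff, mem_singleton_iff, mem_preimage, Subtype.ext_iff]
  rw [nhdsWithin, nhdsWithin, ← h.map_nhds_eq, h1, ← comap_principal, Filter.push_pull]
  rfl

theorem tendsto_difference_quotient_iff {B : Type*} [NormedAddCommGroup B] [NormedSpace ℂ B]
    (f : U → B) (x : U) (d : B) :
    Tendsto (fun y : U => ((y : ℂ) - (x : ℂ))⁻¹ • (f y - f x)) (𝓝[≠] x) (𝓝 d) ↔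
      HasDerivAt (extendZero f) d x := by
  rw [hasDerivAt_iff_tendsto_slope, ← map_val_nhdsNE, tendsto_map'_iff]
  refine tendsto_congr fun y => ?_
  simp [slope, extendZero_apply]

theorem IsHolomorphic.differentiableOn {F B : Type*} [Ring F] [Algebra ℂ F] [TopologicalSpace F]
    [NormedAddCommGroup B] [NormedSpace ℂ B] {f : U → F} (hf : IsHolomorphic f) (g : F →L[ℂ] B) :
    DifferentiableOn ℂ (extendZero fun x => g (f x)) U := by
  intro x hx
  obtain ⟨d, hd⟩ := hf ⟨x, hx⟩
  refine ((tendsto_difference_quotient_iff _ ⟨x, hx⟩ (g d)).1 ?_).differentiableAt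
    |>.differentiableWithinAt
  refine ((g.continuous.tendsto d).comp hd).congr fun y => ?_
  simp

instance (x : U) : NeBot (𝓝[≠] x) := by
  have : NeBot (map ((↑) : U → ℂ) (𝓝[≠] x)) := by
    rw [map_val_nhdsNE]; infer_instance
  exact this.of_map

/-- Holomorphy can be tested against the maps to Banach spaces given by continuous seminorms. -/
theorem isHolomorphic_of_forall_banach {F : Type u} [Ring F] [Algebra ℂ F] [UniformSpace F]
    [IsUniformAddGroup F] [CompleteSpace F] [PolynormableSpace ℂ F] {f : U → F}
    (hf : ∀ (B : Type u) [NormedAddCommGroup B] [NormedSpace ℂ B] [CompleteSpace B] (g : F →L[ℂ] B),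
      DifferentiableOn ℂ (extendZero fun x => g (f x)) U) :
    IsHolomorphic f := by
  intro x
  -- Completeness reduces the existence of a derivative to a Cauchy condition, which can be checked
  -- one seminorm at a time without knowing the limit.
  suffices h : Cauchy (map (fun y : U => ((y : ℂ) - (x : ℂ))⁻¹ • (f y - f x)) (𝓝[≠] x)) by
    exact CompleteSpace.complete h
  rw [IsUniformAddGroup.cauchy_map_iff_tendsto]
  refine ⟨inferInstance, ?_⟩
  rw [(PolynormableSpace.withSeminorms ℂ F).tendsto_nhds]
  rintro ⟨p, hp⟩ ε hε
  obtain ⟨B, _, _, _, g, hg⟩ := exists_banach_of_seminorm p hp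
  have hd := ((hf B g x x.2).differentiableAt (U.isOpen.mem_nhds x.2)).hasDerivAt
  rw [← tendsto_difference_quotient_iff] at hd
  have hc := ((IsUniformAddGroup.cauchy_map_iff_tendsto _ _).1 hd.cauchy_map).2
  filter_upwards [hc.eventually (Metric.ball_mem_nhds 0 hε)] with y hy
  rw [sub_zero, ← hg]
  simpa using hy

/-- Weierstrass' theorem on locally uniform limits, applied after composing with each continuous
linear map to a Banach space. -/
theorem isClosed_holSubalgebra {F : Type u} [Ring F] [Algebra ℂ F] [UniformSpace F]
    [IsUniformAddGroup F] [IsTopologicalRing F] [CompleteSpace F] [PolynormableSpace ℂ F] :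
    IsClosed (holSubalgebra U F : Set C(U, F)) := by
  have : LocallyCompactSpace U := U.isOpen.locallyCompactSpace
  rw [isClosed_iff_clusterPt]
  intro f hf
  have hf : NeBot (𝓝 f ⊓ 𝓟 (holSubalgebra U F : Set C(U, F))) := hf
  refine isHolomorphic_of_forall_banach fun B _ _ _ g => ?_
  have hu : Tendsto id (𝓝 f ⊓ 𝓟 (holSubalgebra U F : Set C(U, F))) (𝓝 f) := inf_le_left
  rw [ContinuousMap.tendsto_iff_tendstoLocallyUniformly] at hu
  have hgu := g.uniformContinuous.comp_tendstoLocallyUniformly hu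
  refine TendstoLocallyUniformlyOn.differentiableOn (φ := 𝓝 f ⊓ 𝓟 (holSubalgebra U F : Set C(U, F)))
    (F := fun h : C(U, F) => extendZero fun x => g (h x)) ?_ ?_ U.isOpen
  · rw [tendstoLocallyUniformlyOn_iff_tendstoLocallyUniformly_comp_coe]
    have h : ∀ h : C(U, F), (extendZero fun x => g (h x)) ∘ ((↑) : U → ℂ) = g ∘ h :=
      fun h => funext fun x => extendZero_apply _ x
    exact (h f).symm ▸ (funext h).symm ▸ hgu
  · filter_upwards [mem_inf_of_right (mem_principal_self _)] with h hh
    exact IsHolomorphic.differentiableOn hh g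

end HolClosed

/-! ### Fréchet spaces: holomorphic functions and quotients -/

section Frechet

theorem isFrechetSpace_of_uniformSpace {E : Type u} [AddCommGroup E] [Module ℂ E] [UniformSpace E]
    [IsUniformAddGroup E] [CompleteSpace E] [T2Space E] [IsCountablyGenerated (𝓤 E)]
    [h : PolynormableSpace ℂ E] : IsFrechetSpace E where
  isTopologicalAddGroup := inferInstance
  polynormable := h
  t2 := inferInstance
  complete := by
    rw [IsUniformAddGroup.rightUniformSpace_eq]; infer_instance
  metrizable := UniformSpace.metrizableSpace

theorem isUniformAddGroup_continuousMap (X F : Type*) [TopologicalSpace X] [AddCommGroup F]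
    [UniformSpace F] [IsUniformAddGroup F] : IsUniformAddGroup C(X, F) := by
  let φ : C(X, F) →+ UniformOnFun X F {K | IsCompact K} :=
    { toFun := ContinuousMap.toUniformOnFunIsCompact
      map_zero' := rfl
      map_add' := fun _ _ => rfl }
  exact IsUniformInducing.isUniformAddGroup φ
    ContinuousMap.isUniformEmbedding_toUniformOnFunIsCompact.isUniformInducing

theorem isFrechetSpace_hol {U : TopologicalSpace.Opens ℂ} {F : Type u} [Ring F] [Algebra ℂ F]
    [UniformSpace F] [IsUniformAddGroup F] [IsTopologicalRing F] [ContinuousSMul ℂ F]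
    [CompleteSpace F] [T2Space F] [IsCountablyGenerated (𝓤 F)] [PolynormableSpace ℂ F] :
    IsFrechetSpace (Hol U F) := by
  have : LocallyCompactSpace U := U.isOpen.locallyCompactSpace
  have : IsUniformAddGroup C(U, F) := isUniformAddGroup_continuousMap U F
  have : IsUniformAddGroup (Hol U F) := IsUniformInducing.isUniformAddGroup
    (holSubalgebra U F).val ⟨rfl⟩
  have : IsCountablyGenerated (𝓤 (Hol U F)) := Filter.comap.isCountablyGenerated _ _
  have : CompleteSpace (Hol U F) := isClosed_holSubalgebra.completeSpace_coe
  have : LocallyConvexSpace ℝ F := locallyConvexSpace_of_polynormableSpace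
  have : ContinuousSMul ℝ F := IsScalarTower.continuousSMul ℂ
  have : PolynormableSpace ℂ C(U, F) :=
    polynormableSpace_of_locallyConvexSpace (h := ContinuousMap.instLocallyConvexSpace)
  have : PolynormableSpace ℂ (Hol U F) :=
    Topology.IsInducing.polynormableSpace (𝕜 := ℂ) (f := (holSubalgebra U F).val.toLinearMap) ⟨rfl⟩
  exact isFrechetSpace_of_uniformSpace

theorem isCountablyGenerated_uniformity_completion (X : Type*) [u : UniformSpace X]
    [IsCountablyGenerated (𝓤 X)] : IsCountablyGenerated (𝓤 (UniformSpace.Completion X)) := by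
  obtain ⟨I, rfl⟩ := UniformSpace.metrizable_uniformity X
  infer_instance

theorem isFrechetSpace_quotient {R : Type u} [Ring R] [Algebra ℂ R] [TopologicalSpace R]
    [IsTopologicalRing R] [ContinuousSMul ℂ R] (hR : IsFrechetSpace R) (I : Ideal R)
    [I.IsTwoSided] (hI : IsClosed (I : Set R)) :
    @IsFrechetSpace (R ⧸ I) _ _ (QuotientModule.Quotient.topologicalSpace I) := by
  let _ := QuotientModule.Quotient.topologicalSpace I
  have := hR.isTopologicalAddGroup
  have := hR.metrizable
  have := hR.polynormable
  have hmk : IsOpenQuotientMap (Ideal.Quotient.mk I) := Submodule.isOpenQuotientMap_mkQ I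
  have hadd : IsTopologicalAddGroup (R ⧸ I) := Submodule.topologicalAddGroup_quotient I
  have hsmul : ContinuousSMul ℂ (R ⧸ I) := by
    refine ⟨(IsOpenQuotientMap.id.prodMap hmk).isQuotientMap.continuous_iff.2 ?_⟩
    exact hmk.continuous.comp (continuous_fst.smul continuous_snd :
      Continuous fun q : ℂ × R => q.1 • q.2)
  have ht3 : T3Space (R ⧸ I) := Submodule.t3_quotient_of_isClosed I
  have : IsCountablyGenerated (𝓝 (0 : R ⧸ I)) := by
    rw [← map_zero (Ideal.Quotient.mk I), ← hmk.map_nhds_eq]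
    exact Filter.map.isCountablyGenerated _ _
  let u := IsTopologicalAddGroup.rightUniformSpace (R ⧸ I)
  have : IsUniformAddGroup (R ⧸ I) := isUniformAddGroup_of_addCommGroup
  have : IsCountablyGenerated (𝓤 (R ⧸ I)) := IsUniformAddGroup.uniformity_countably_generated
  have : CompleteSpace (R ⧸ I) :=
    @QuotientAddGroup.completeSpace_right' R _ _ _ _ I.toAddSubgroup _ hR.complete
  have : PolynormableSpace ℂ (R ⧸ I) :=
    polynormableSpace_of_isOpenQuotientMap (Ideal.Quotient.mkₐ ℂ I).toLinearMap hmk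
  exact isFrechetSpace_of_uniformSpace

end Frechet

/-! ### Metrizability of the analytic free product -/

section FreeProduct

variable {I : Type u} [DecidableEq I] (A : I → Type u)
  [∀ i, Ring (A i)] [∀ i, Algebra ℂ (A i)]

/-- The homomorphism from the algebraic free product given by homomorphisms of the factors. -/
def freeLift {B : Type*} [Ring B] [Algebra ℂ B] (f : ∀ i, A i →ₐ[ℂ] B) :
    AlgFreeProduct A →ₐ[ℂ] B :=
  LinearAlgebra.FreeProduct.lift ℂ A (fun {i} => f i)

theorem freeLift_algIncl {B : Type*} [Ring B] [Algebra ℂ B] (f : ∀ i, A i →ₐ[ℂ] B) (i : I)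
    (a : A i) : freeLift A f (algIncl A i a) = f i a :=
  DFunLike.congr_fun (LinearAlgebra.FreeProduct.lift_comp_ι (i := i) ℂ A (fun {i} => f i)) a

theorem algFreeProduct_hom_ext {B : Type*} [Ring B] [Algebra ℂ B] {f g : AlgFreeProduct A →ₐ[ℂ] B}
    (h : ∀ i a, f (algIncl A i a) = g (algIncl A i a)) : f = g := by
  have hf := LinearAlgebra.FreeProduct.lift_unique ℂ A (fun {i} => g.comp (algIncl A i)) f
    fun i => AlgHom.ext (h i)
  have hg := LinearAlgebra.FreeProduct.lift_unique ℂ A (fun {i} => g.comp (algIncl A i)) g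
    fun _ => rfl
  exact hf.trans hg.symm

/-- The universal property gives a homomorphism into `S` whose composite with the inclusion fixes
the factors, hence is the identity. -/
theorem mem_subalgebra_of_forall_algIncl {S : Subalgebra ℂ (AlgFreeProduct A)}
    (hS : ∀ i a, algIncl A i a ∈ S) (x : AlgFreeProduct A) : x ∈ S := by
  have h : S.val.comp (freeLift A fun i => (algIncl A i).codRestrict S (hS i)) = AlgHom.id ℂ _ :=
    algFreeProduct_hom_ext A fun i a => by
      simp [freeLift_algIncl]
  have := DFunLike.congr_fun h x
  rw [AlgHom.id_apply] at this
  rw [← this]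
  exact Subtype.property _

variable [∀ i, TopologicalSpace (A i)]

variable {A} in
/-- The restrictions to the factors of the seminorms in this set are bounded by `1` on `V i`. -/
def boundedFreeSeminorms (V : ∀ i, Set (A i)) : Set (FreeSeminorm A) :=
  {p | ∀ i, ∀ a ∈ V i, p.1 (algIncl A i a) ≤ 1}

instance : CompleteSpace (AnalyticFreeProduct A) :=
  inferInstanceAs (CompleteSpace (UniformSpace.Completion (AlgFreeProduct A)))

instance : T2Space (AnalyticFreeProduct A) :=
  inferInstanceAs (T2Space (UniformSpace.Completion (AlgFreeProduct A)))

instance : PolynormableSpace ℂ (AnalyticFreeProduct A) := by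
  have := (withSeminorms_freeSeminorms A).toPolynormableSpace
  let i : AlgFreeProduct A →ₗ[ℂ] AnalyticFreeProduct A :=
    { toFun := fun a => (a : UniformSpace.Completion (AlgFreeProduct A))
      map_add' := fun a b => UniformSpace.Completion.coe_add a b
      map_smul' := fun c a => UniformSpace.Completion.coe_smul c a }
  exact polynormableSpace_of_isDenseInducing i UniformSpace.Completion.isDenseInducing_coe

variable [∀ i, ContinuousSMul ℂ (A i)]

/-- Elements on which the family is uniformly bounded form a subalgebra, by submultiplicativity, and
it contains every factor because neighbourhoods of `0` are absorbing. -/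
theorem bddAbove_boundedFreeSeminorms [Nonempty I] {V : ∀ i, Set (A i)} (hV : ∀ i, V i ∈ 𝓝 0) :
    BddAbove (range fun p : boundedFreeSeminorms V => p.1.1) := by
  rw [Seminorm.bddAbove_range_iff]
  have hfac : ∀ i a, ∃ C : ℝ, ∀ p : boundedFreeSeminorms V, p.1.1 (algIncl A i a) ≤ C := by
    intro i a
    obtain ⟨c, hc, hca⟩ : ∃ c : ℂ, c ≠ 0 ∧ c • a ∈ V i := by
      have ht : Tendsto (fun c : ℂ => c • a) (𝓝[≠] 0) (𝓝 0) := by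
        have : Tendsto (fun c : ℂ => c • a) (𝓝 0) (𝓝 ((0 : ℂ) • a)) :=
          (continuous_id.smul continuous_const).tendsto 0
        rw [zero_smul] at this
        exact this.mono_left nhdsWithin_le_nhds
      obtain ⟨c, hc⟩ := ((ht.eventually (hV i)).and self_mem_nhdsWithin).exists
      exact ⟨c, hc.2, hc.1⟩
    refine ⟨‖c‖⁻¹, fun p => ?_⟩
    have h := p.2 i _ hca
    rw [map_smul, map_smul_eq_mul] at h
    rw [← one_div, le_div_iff₀' (norm_pos_iff.2 hc)]
    exact h
  let S : Subalgebra ℂ (AlgFreeProduct A) :=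
    { carrier := {x | ∃ C : ℝ, ∀ p : boundedFreeSeminorms V, p.1.1 x ≤ C}
      mul_mem' := by
        rintro x y ⟨C, hC⟩ ⟨D, hD⟩
        refine ⟨C * D, fun p => (p.1.2.1 x y).trans ?_⟩
        exact mul_le_mul (hC p) (hD p) (apply_nonneg _ _) ((apply_nonneg _ _).trans (hC p))
      add_mem' := by
        rintro x y ⟨C, hC⟩ ⟨D, hD⟩
        exact ⟨C + D, fun p => (map_add_le_add _ x y).trans (add_le_add (hC p) (hD p))⟩
      algebraMap_mem' := by
        intro c
        -- The seminorms are not normalised at `1`, so scalars must be bounded through some factor;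
        -- this is where `I` must be nonempty.
        obtain ⟨C, hC⟩ := hfac (Classical.arbitrary I) (algebraMap ℂ _ c)
        exact ⟨C, fun p => by simpa using hC p⟩ }
  intro x
  obtain ⟨C, hC⟩ := mem_subalgebra_of_forall_algIncl A (S := S) hfac x
  exact ⟨C, by rintro _ ⟨p, rfl⟩; exact hC p⟩

variable [∀ i, IsTopologicalRing (A i)]

/-- The largest seminorm with a given bound on the factors. -/
def maxFreeSeminorm [Nonempty I] (V : ∀ i, Set (A i)) (hV : ∀ i, V i ∈ 𝓝 0) : FreeSeminorm A := by
  refine ⟨⨆ p : boundedFreeSeminorms V, p.1.1, fun a b => ?_, fun i => ?_⟩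
  all_goals have hb := bddAbove_boundedFreeSeminorms A hV
  · have hb' := (Seminorm.bddAbove_range_iff).1 hb
    rw [Seminorm.iSup_apply hb, Seminorm.iSup_apply hb, Seminorm.iSup_apply hb]
    have hn : ∀ x : AlgFreeProduct A, 0 ≤ ⨆ p : boundedFreeSeminorms V, p.1.1 x :=
      fun x => Real.iSup_nonneg fun p => apply_nonneg _ _
    refine Real.iSup_le (fun p => (p.1.2.1 a b).trans ?_) (mul_nonneg (hn a) (hn b))
    exact mul_le_mul (le_ciSup (hb' a) p) (le_ciSup (hb' b) p) (apply_nonneg _ _) (hn a)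
  · let q : Seminorm ℂ (A i) :=
      (⨆ p : boundedFreeSeminorms V, p.1.1).comp (algIncl A i).toLinearMap
    -- The bound on `V i` is only `≤ 1`, while balls are open; any radius above `1` works.
    have hq : q.ball 0 2 ∈ 𝓝 0 := by
      filter_upwards [hV i] with a ha
      rw [Seminorm.mem_ball_zero]
      refine lt_of_le_of_lt (b := 1) ?_ one_lt_two
      change (⨆ p : boundedFreeSeminorms V, p.1.1) (algIncl A i a) ≤ 1
      rw [Seminorm.iSup_apply hb]
      exact Real.iSup_le (fun p => p.2 i a ha) zero_le_one
    exact Seminorm.continuous hq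

theorem le_maxFreeSeminorm [Nonempty I] {V : ∀ i, Set (A i)} (hV : ∀ i, V i ∈ 𝓝 0)
    {p : FreeSeminorm A} (hp : p ∈ boundedFreeSeminorms V) : p.1 ≤ (maxFreeSeminorm A V hV).1 :=
  le_ciSup (f := fun p : boundedFreeSeminorms V => p.1.1) (bddAbove_boundedFreeSeminorms A hV)
    (⟨p, hp⟩ : boundedFreeSeminorms V)

/-- The maximal seminorms of countable bases of neighbourhoods dominate every defining seminorm:
with finitely many factors one index `M` serves all of them. -/
theorem firstCountableTopology_algFreeProduct [Nonempty I] [Finite I]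
    [∀ i, FirstCountableTopology (A i)] : FirstCountableTopology (AlgFreeProduct A) := by
  choose V hV using fun i => (𝓝 (0 : A i)).exists_antitone_basis
  let q : ℕ → FreeSeminorm A := fun k =>
    maxFreeSeminorm A (fun i => V i k) fun i => (hV i).mem k
  have hle : ∀ p : FreeSeminorm A, ∃ k, p.1 ≤ (q k).1 := by
    intro p
    have h1 : ∀ i, ∃ k, ∀ l, k ≤ l → ∀ a ∈ V i l, p.1 (algIncl A i a) ≤ 1 := by
      intro i
      have h0 : {a : A i | p.1 (algIncl A i a) < 1} ∈ 𝓝 0 :=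
        (isOpen_lt (p.2.2 i) continuous_const).mem_nhds (by simp)
      obtain ⟨k, -, hk⟩ := (hV i).1.mem_iff.1 h0
      exact ⟨k, fun l hl a ha => le_of_lt (hk ((hV i).2 hl ha))⟩
    choose k hk using h1
    obtain ⟨M, hM⟩ := Finite.exists_le k
    exact ⟨M, le_maxFreeSeminorm A _ fun i a ha => hk i M (hM i) a ha⟩
  have hw : WithSeminorms fun k => (q k).1 := by
    refine (withSeminorms_freeSeminorms A).congr (fun k => ?_) (fun p => ?_)
    · exact ⟨{q k}, 1, by simp [freeSeminorms]⟩
    · obtain ⟨k, hk⟩ := hle p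
      exact ⟨{k}, 1, by simpa [freeSeminorms] using hk⟩
  exact hw.firstCountableTopology

theorem isCountablyGenerated_uniformity_analyticFreeProduct [Nonempty I] [Finite I]
    [∀ i, FirstCountableTopology (A i)] : IsCountablyGenerated (𝓤 (AnalyticFreeProduct A)) := by
  have := firstCountableTopology_algFreeProduct A
  have : IsCountablyGenerated (𝓤 (AlgFreeProduct A)) :=
    IsUniformAddGroup.uniformity_countably_generated
  exact isCountablyGenerated_uniformity_completion (AlgFreeProduct A)

end FreeProduct

/-! ### Topologically free modules are projective -/

section Free

variable {A : Type u} [Ring A] [Algebra ℂ A] [TopologicalSpace A]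
  {P : Type u} [AddCommGroup P] [Module ℂ P] [Module A P] [TopologicalSpace P]

theorem IsCompletedProjTensor.hom_ext {V E T G : Type u}
    [AddCommGroup V] [Module ℂ V] [TopologicalSpace V]
    [AddCommGroup E] [Module ℂ E] [TopologicalSpace E]
    [AddCommGroup T] [Module ℂ T] [TopologicalSpace T]
    [AddCommGroup G] [Module ℂ G] [TopologicalSpace G] {β : V →ₗ[ℂ] E →ₗ[ℂ] T}
    (hβ : IsCompletedProjTensor β) (hG : IsCompleteLCS G) {f g : T →L[ℂ] G}
    (h : ∀ v e, f (β v e) = g (β v e)) : f = g :=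
  (hβ.existsUnique_lift G hG (β.compr₂ g.toLinearMap) (g.continuous.comp hβ.continuous)).unique h
    fun _ _ => rfl

theorem IsTopFree.isTopProjective [IsScalarTower ℂ A P] (hP : IsFrechetModule A P)
    (h : IsTopFree A P) : IsTopProjective A P := by
  obtain ⟨E, _, _, _, -, β, hβ, hA⟩ := h
  intro X Y _ _ _ _ _ _ _ _ _ _ hX hY σ ⟨κ, hκ⟩ φ
  -- Lift the generators `1 ⊗ e` by the linear section `κ` and extend `A`-linearly; `κ` itself need
  -- not be `A`-linear.
  let b : A →ₗ[ℂ] E →ₗ[ℂ] X := LinearMap.mk₂ ℂ (fun a e => a • κ (φ (β 1 e)))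
    (fun a b e => add_smul _ _ _) (fun c a e => smul_assoc _ _ _)
    (fun a d e => by simp only [map_add, smul_add])
    (fun c a e => by
      have h := (φ.restrictScalars ℂ).map_smul c (β 1 e)
      simp only [ContinuousLinearMap.coe_restrictScalars'] at h
      rw [map_smul, h, map_smul, smul_comm])
  have hb : Continuous fun q : A × E => b q.1 q.2 :=
    hX.continuous_action.comp (continuous_fst.prodMk (κ.continuous.comp (φ.continuous.comp
      (hβ.continuous.comp (continuous_const.prodMk continuous_snd)))))
  obtain ⟨f, hf, -⟩ := hβ.existsUnique_lift X hX.toIsCompleteLCS b hb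
  have hfA : ∀ (a : A) (t : P), f (a • t) = a • f t := by
    intro a t
    let m : P →L[ℂ] P :=
      { toFun := fun t => a • t
        map_add' := smul_add a
        map_smul' := fun c t => smul_comm a c t
        cont := hP.continuous_action.comp (continuous_const.prodMk continuous_id) }
    let m' : X →L[ℂ] X :=
      { toFun := fun t => a • t
        map_add' := smul_add a
        map_smul' := fun c t => smul_comm a c t
        cont := hX.continuous_action.comp (continuous_const.prodMk continuous_id) }
    refine DFunLike.congr_fun (hβ.hom_ext hX.toIsCompleteLCS (f := f.comp m) (g := m'.comp f) ?_) t
    intro v e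
    change f (a • β v e) = a • f (β v e)
    rw [← hA, hf, hf]
    exact mul_smul _ _ _
  refine ⟨{ toFun := f, map_add' := map_add f, map_smul' := hfA, cont := f.continuous }, ?_⟩
  have h := hβ.hom_ext hY.toIsCompleteLCS (f := (σ.restrictScalars ℂ).comp f)
    (g := φ.restrictScalars ℂ) fun v e => by
      change σ (f (β v e)) = φ (β v e)
      rw [hf]
      change σ (v • κ (φ (β 1 e))) = _
      rw [map_smul, hκ, ← map_smul, ← hA, mul_one]
  ext t
  exact DFunLike.congr_fun h t

end Free

/-! ### The Fréchet module structure on the deformation -/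

section FrechetODef

variable (U : TopologicalSpace.Opens ℂ) (F : Type u) [Ring F] [Algebra ℂ F] [TopologicalSpace F]
  [IsTopologicalRing F]

theorem continuous_constHol : Continuous (constHol U : F → Hol U F) :=
  Continuous.subtype_mk ContinuousMap.continuous_const' _

instance [ContinuousSMul ℂ F] : ContinuousSMul ℂ (Hol U F) := by
  have : LocallyCompactSpace U := U.isOpen.locallyCompactSpace
  exact inferInstanceAs (ContinuousSMul ℂ (holSubalgebra U F).toSubmodule)

theorem continuous_scalarHol [ContinuousSMul ℂ F] : Continuous (scalarHol U F) :=
  Continuous.subtype_mk ((ContinuousMap.continuous_postcomp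
    (⟨algebraMap ℂ F, continuous_algebraMap ℂ F⟩ : C(ℂ, F))).comp continuous_subtype_val) _

theorem isFrechetModule_holCx : IsFrechetModule HolCx HolCx where
  toIsFrechetSpace := isFrechetSpace_hol
  continuous_action := by
    have : IsTopologicalRing (Hol puncturedPlane ℂ) := inferInstance
    exact this.continuous_mul

theorem isClosed_closedIdealSpan {R : Type u} [Ring R] [TopologicalSpace R] (S : Set R) :
    IsClosed (closedIdealSpan S : Set R) := by
  rw [closedIdealSpan, Submodule.coe_sInf]
  exact isClosed_biInter fun I hI => hI.2.1

theorem subset_closedIdealSpan {R : Type u} [Ring R] [TopologicalSpace R] (S : Set R) :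
    S ⊆ closedIdealSpan S := by
  rw [closedIdealSpan, Submodule.coe_sInf]
  exact subset_iInter₂ fun I hI => hI.2.2

variable (n : ℕ) (r : ℝ≥0∞)

/-- The quotient homomorphism onto `ODef n r`. -/
def toODef : Hol puncturedPlane (FreePolydisk n r) →ₐ[ℂ] ODef n r :=
  Ideal.Quotient.mkₐ ℂ (defIdeal n r)

theorem isOpenQuotientMap_toODef : IsOpenQuotientMap (toODef n r) :=
  Submodule.isOpenQuotientMap_mkQ (defIdeal n r)

theorem isFrechetModule_oDef [NeZero n] : IsFrechetModule HolCx (ODef n r) where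
  toIsFrechetSpace := by
    have : TopologicalSpace.MetrizableSpace (Hol (disk r) ℂ) := isFrechetSpace_hol.metrizable
    have : IsCountablyGenerated (𝓤 (FreePolydisk n r)) :=
      isCountablyGenerated_uniformity_analyticFreeProduct _
    exact isFrechetSpace_quotient isFrechetSpace_hol (defIdeal n r) (isClosed_closedIdealSpan _)
  continuous_action := by
    refine (IsOpenQuotientMap.id.prodMap
      (isOpenQuotientMap_toODef n r)).isQuotientMap.continuous_iff.2 ?_
    exact (isOpenQuotientMap_toODef n r).continuous.comp
      (((continuous_scalarHol _ _).comp continuous_fst).mul continuous_snd)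

end FrechetODef

/-! ### Powers of `q`-commuting elements -/

section QCommuting

theorem mul_pow_of_q_commuting {R : Type*} [Ring R] {x y z : R}
    (hy : Commute z y) (h : x * y = z * (y * x)) (k : ℕ) : x * y ^ k = z ^ k * (y ^ k * x) := by
  induction k with
  | zero => simp
  | succ k ih =>
    calc x * y ^ (k + 1) = x * y ^ k * y := by rw [pow_succ, mul_assoc]
      _ = z ^ k * y ^ k * (x * y) := by rw [ih]; simp only [mul_assoc]
      _ = z ^ k * (y ^ k * z) * (y * x) := by rw [h]; simp only [mul_assoc]
      _ = z ^ (k + 1) * (y ^ (k + 1) * x) := by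
        rw [← (hy.pow_right k).eq]; simp only [pow_succ, mul_assoc]

theorem pow_mul_pow_of_q_commuting {R : Type*} [Ring R] {x y z : R} (hx : Commute z x)
    (hy : Commute z y) (h : x * y = z * (y * x)) (j k : ℕ) :
    x ^ j * y ^ k = z ^ (j * k) * (y ^ k * x ^ j) := by
  induction j with
  | zero => simp
  | succ j ih =>
    calc x ^ (j + 1) * y ^ k = x ^ j * (x * y ^ k) := by rw [pow_succ, mul_assoc]
      _ = x ^ j * z ^ k * (y ^ k * x) := by
        rw [mul_pow_of_q_commuting hy h]; simp only [mul_assoc]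
      _ = z ^ k * (x ^ j * y ^ k) * x := by
        rw [← (hx.pow_pow k j).eq]; simp only [mul_assoc]
      _ = z ^ ((j + 1) * k) * (y ^ k * x ^ (j + 1)) := by
        rw [ih, add_mul, one_mul, add_comm (j * k), pow_add, pow_succ]; simp only [mul_assoc]

end QCommuting

/-! ### The maximum principle on an annulus -/

section Annulus

theorem norm_le_of_norm_le_on_circles {f : ℂ → ℂ} (hf : DifferentiableOn ℂ f {z | z ≠ 0}) {C : ℝ}
    (h₁ : ∀ z : ℂ, ‖z‖ = 1 / 2 → ‖f z‖ ≤ C) (h₂ : ∀ z : ℂ, ‖z‖ = 2 → ‖f z‖ ≤ C) :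
    ‖f 1‖ ≤ C := by
  let V : Set ℂ := {z | 1 / 2 < ‖z‖} ∩ {z | ‖z‖ < 2}
  have hcl : closure V ⊆ {z | 1 / 2 ≤ ‖z‖} ∩ {z | ‖z‖ ≤ 2} :=
    closure_minimal (fun z hz => ⟨(mem_ofPred.1 hz.1).le, (mem_ofPred.1 hz.2).le⟩)
      ((isClosed_le continuous_const continuous_norm).inter
        (isClosed_le continuous_norm continuous_const))
  have hV : IsOpen V := (isOpen_lt continuous_const continuous_norm).inter
    (isOpen_lt continuous_norm continuous_const)
  have hne : closure V ⊆ {z | z ≠ 0} := by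
    rintro z hz rfl
    have := (hcl hz).1
    norm_num at this
  refine Complex.norm_le_of_forall_mem_frontier_norm_le (U := V) ?_ ?_ ?_ (subset_closure ?_)
  · exact (Metric.isBounded_ball (x := (0 : ℂ)) (r := 2)).subset fun z hz =>
      mem_ball_zero_iff.2 (mem_ofPred.1 hz.2)
  · exact (hf.mono hne).diffContOnCl
  · intro z hz
    rw [hV.frontier_eq] at hz
    obtain ⟨hz1, hz2⟩ := hcl hz.1
    rcases eq_or_lt_of_le (mem_ofPred.1 hz1) with h | h
    · exact h₁ z h.symm
    rcases eq_or_lt_of_le (mem_ofPred.1 hz2) with h' | h'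
    · exact h₂ z h'
    exact absurd ⟨h, h'⟩ hz.2
  · constructor <;> norm_num

/-- If `g` and `z ^ (2 * m) * g` are bounded by `C` on the circles of radii `2⁻¹` and `2`, then
`g 1` is small. -/
theorem norm_apply_one_le {g : ℂ → ℂ} (hg : DifferentiableOn ℂ g {z | z ≠ 0}) {C : ℝ} (m : ℕ)
    (h₁ : ∀ z : ℂ, ‖z‖ = 1 / 2 → ‖g z‖ ≤ C)
    (h₂ : ∀ z : ℂ, ‖z‖ = 2 → ‖z ^ (2 * m) * g z‖ ≤ C) : ‖g 1‖ ≤ C / 2 ^ m := by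
  -- Half of the factor `z ^ (2 * m)` is the balanced choice: `|z|^m = 2^(-m)` on the inner circle,
  -- and the missing `|z|^m = 2^m` is divided out on the outer one.
  have := norm_le_of_norm_le_on_circles (f := fun z => z ^ m * g z) (C := C / 2 ^ m)
    ((differentiableOn_id.pow m).mul hg) (fun z hz => ?_) fun z hz => ?_
  · simpa using this
  · rw [norm_mul, norm_pow, hz, one_div, inv_pow, div_eq_inv_mul]
    exact mul_le_mul_of_nonneg_left (h₁ z hz) (by positivity)
  · have h := h₂ z hz
    rw [norm_mul, norm_pow, hz, two_mul, pow_add, mul_assoc] at h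
    rw [norm_mul, norm_pow, hz, le_div_iff₀' (by positivity)]
    exact h

end Annulus

/-! ### Exponential against super-exponential growth -/

section Bounds

/-- The exponent `k + 1` absorbs `p 1`, which need not be at most `1`. -/
theorem seminorm_pow_le {R : Type*} [Ring R] [Algebra ℂ R] {p : Seminorm ℂ R}
    (hp : ∀ a b, p (a * b) ≤ p a * p b) {x : R} {B : ℝ} (h1 : p 1 ≤ B) (hx : p x ≤ B) (k : ℕ) :
    p (x ^ k) ≤ B ^ (k + 1) := by
  have hB : 0 ≤ B := (apply_nonneg p 1).trans h1
  induction k with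
  | zero => simpa using h1
  | succ k ih =>
    rw [pow_succ, pow_succ B]
    exact (hp _ _).trans (mul_le_mul ih hx (apply_nonneg _ _) (by positivity))

theorem not_forall_pow_le {q B C : ℝ} (hq : 0 < q) (hB : 0 < B) :
    ¬ ∀ j : ℕ, q ^ (4 * j) ≤ C * B ^ (4 * j) / 2 ^ (2 * j ^ 2) := by
  intro h
  -- For `j ≥ j₁` the assumed inequality forces `2 ^ j ≤ C`, the extra `2` in the numerator being
  -- what survives; `j ≥ j₂` excludes this.
  obtain ⟨j₁, hj₁⟩ := pow_unbounded_of_one_lt (2 * B ^ 4 / q ^ 4) (one_lt_two (α := ℝ))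
  obtain ⟨j₂, hj₂⟩ := pow_unbounded_of_one_lt C (one_lt_two (α := ℝ))
  let j := j₁ + j₂
  have h1 : 2 * B ^ 4 ≤ 2 ^ (2 * j) * q ^ 4 := by
    rw [div_lt_iff₀ (by positivity)] at hj₁
    refine hj₁.le.trans (mul_le_mul_of_nonneg_right ?_ (by positivity))
    exact pow_le_pow_right₀ one_le_two (by omega)
  have h2 : C < 2 ^ j := hj₂.trans_le (pow_le_pow_right₀ one_le_two (by omega))
  have h3 := pow_le_pow_left₀ (by positivity) h1 j
  have h4 := h j
  rw [le_div_iff₀ (by positivity)] at h4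
  have h5 : (2 * B ^ 4) ^ j ≤ C * B ^ (4 * j) := by
    refine h3.trans (le_trans (le_of_eq ?_) h4)
    rw [mul_pow, ← pow_mul, ← pow_mul, mul_comm]
    congr 2
    ring
  rw [mul_pow, ← pow_mul] at h5
  exact absurd (le_of_mul_le_mul_right h5 (by positivity)) (not_le.2 h2)

end Bounds

/-! ### Characters over the point `z = 1` -/

section Character

variable {n : ℕ} {r : ℝ≥0∞}

/-- Evaluation of holomorphic functions at a point. -/
def evalHol {U : TopologicalSpace.Opens ℂ} {F : Type u} [Ring F] [Algebra ℂ F] [TopologicalSpace F]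
    [IsTopologicalRing F] (w : U) : Hol U F →ₐ[ℂ] F where
  toFun f := f.1 w
  map_one' := rfl
  map_mul' _ _ := rfl
  map_zero' := rfl
  map_add' _ _ := rfl
  commutes' _ := rfl

theorem continuous_evalHol {U : TopologicalSpace.Opens ℂ} {F : Type u} [Ring F] [Algebra ℂ F]
    [TopologicalSpace F] [IsTopologicalRing F] (w : U) : Continuous (evalHol w : Hol U F → F) :=
  (continuous_eval_const w).comp continuous_subtype_val

/-- The absolute value of the lifted character is itself one of the seminorms defining the topology.
-/
theorem continuous_freeLift {I : Type u} [DecidableEq I] (A : I → Type u)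
    [∀ i, Ring (A i)] [∀ i, Algebra ℂ (A i)] [∀ i, TopologicalSpace (A i)]
    (f : ∀ i, A i →ₐ[ℂ] ℂ) (hf : ∀ i, Continuous (f i)) : Continuous (freeLift A f) := by
  let p : FreeSeminorm A := ⟨(normSeminorm ℂ ℂ).comp (freeLift A f).toLinearMap,
    fun a b => by simp, fun i => by simpa [freeLift_algIncl] using (hf i).norm⟩
  have hp : Continuous p.1 := (withSeminorms_freeSeminorms A).continuous_seminorm p
  refine continuous_of_continuousAt_zero (freeLift A f) ?_
  rw [ContinuousAt, map_zero, tendsto_zero_iff_norm_tendsto_zero]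
  have := hp.tendsto 0
  rwa [map_zero] at this

/-- The character of the analytic free product given by characters of the factors. -/
def analyticCharacter {I : Type u} [DecidableEq I] (A : I → Type u)
    [∀ i, Ring (A i)] [∀ i, Algebra ℂ (A i)] [∀ i, TopologicalSpace (A i)]
    (f : ∀ i, A i →ₐ[ℂ] ℂ) (hf : ∀ i, Continuous (f i)) : AnalyticFreeProduct A →ₐ[ℂ] ℂ :=
  { (UniformSpace.Completion.extensionHom (freeLift A f : AlgFreeProduct A →+* ℂ)
      (continuous_freeLift A f hf) : UniformSpace.Completion (AlgFreeProduct A) →+* ℂ) with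
    commutes' := fun c => by
      refine (UniformSpace.Completion.extensionHom_coe (freeLift A f : AlgFreeProduct A →+* ℂ)
        (continuous_freeLift A f hf) (algebraMap ℂ (AlgFreeProduct A) c)).trans ?_
      exact (freeLift A f).commutes c }

section

variable {I : Type u} [DecidableEq I] (A : I → Type u)
  [∀ i, Ring (A i)] [∀ i, Algebra ℂ (A i)] [∀ i, TopologicalSpace (A i)]
  (f : ∀ i, A i →ₐ[ℂ] ℂ) (hf : ∀ i, Continuous (f i))

theorem continuous_analyticCharacter : Continuous (analyticCharacter A f hf) :=
  UniformSpace.Completion.continuous_extension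

theorem analyticCharacter_incl (i : I) (a : A i) :
    analyticCharacter A f hf (incl A i a) = f i a :=
  (UniformSpace.Completion.extensionHom_coe (freeLift A f : AlgFreeProduct A →+* ℂ)
    (continuous_freeLift A f hf) (algIncl A i a)).trans (freeLift_algIncl A f i a)

end

/-- The character of the free polydisk algebra given by a point on the diagonal. -/
def diagCharacter (w : disk r) : FreePolydisk n r →ₐ[ℂ] ℂ :=
  analyticCharacter (I := Fin n) (fun _ => Hol (disk r) ℂ) (fun _ => evalHol w)
    fun _ => continuous_evalHol w

theorem continuous_diagCharacter (w : disk r) :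
    Continuous (diagCharacter (n := n) w) := by
  have h := continuous_analyticCharacter (I := Fin n) (fun _ => Hol (disk r) ℂ)
    (fun _ => evalHol w) fun _ => continuous_evalHol w
  exact h

theorem diagCharacter_zeta (w : disk r) (i : Fin n) : diagCharacter w (zeta n r i) = w := by
  have h := analyticCharacter_incl (I := Fin n) (fun _ => Hol (disk r) ℂ) (fun _ => evalHol w)
    (fun _ => continuous_evalHol w) i (coord (disk r))
  exact h

/-- The point `1` of the punctured plane. -/
def onePoint : puncturedPlane := ⟨1, one_ne_zero⟩

theorem defIdeal_le_ker (w : disk r) (a : Hol puncturedPlane (FreePolydisk n r))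
    (ha : a ∈ defIdeal n r) :
    ((diagCharacter w).comp (evalHol onePoint)) a = 0 := by
  let χ := (diagCharacter w).comp (evalHol onePoint : Hol puncturedPlane (FreePolydisk n r) →ₐ[ℂ] _)
  have hχ : Continuous χ := (continuous_diagCharacter w).comp (continuous_evalHol onePoint)
  -- The kernel is a closed two-sided ideal, and at `z = 1` each relator is a commutator, which a
  -- character kills.
  have hle : defIdeal n r ≤ RingHom.ker χ := by
    refine sInf_le ⟨inferInstance, isClosed_singleton.preimage hχ, ?_⟩
    rintro _ ⟨i, j, -, rfl⟩
    change diagCharacter w (zeta n r i * zeta n r j -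
      algebraMap ℂ (FreePolydisk n r) 1 * (zeta n r j * zeta n r i)) = 0
    rw [map_one, one_mul, map_sub, map_mul, map_mul, mul_comm, sub_self]
  exact hle ha

/-- The character of `ODef n r` given by `1` and a point on the diagonal. -/
def oDefCharacter (w : disk r) : ODef n r →ₐ[ℂ] ℂ :=
  Ideal.Quotient.liftₐ (defIdeal n r)
    ((diagCharacter w).comp (evalHol onePoint)) (defIdeal_le_ker w)

theorem continuous_oDefCharacter (w : disk r) : Continuous (oDefCharacter w : ODef n r → ℂ) :=
  (isOpenQuotientMap_toODef n r).isQuotientMap.continuous_iff.2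
    ((continuous_diagCharacter w).comp (continuous_evalHol onePoint))

theorem oDefCharacter_smul (w : disk r) (f : HolCx) (p : ODef n r) :
    oDefCharacter w (f • p) = evalHol onePoint f * oDefCharacter w p := by
  obtain ⟨g, rfl⟩ := (isOpenQuotientMap_toODef n r).surjective p
  change diagCharacter w (algebraMap ℂ (FreePolydisk n r) (evalHol onePoint f) *
    evalHol onePoint g) = _ * diagCharacter w (evalHol onePoint g)
  rw [map_mul]
  congr 1
  exact (diagCharacter w).commutes _

end Character

/-! ### Decay of morphisms to `𝒪(ℂ^×)` and failure of projectivity -/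

section Projectivity

variable {n : ℕ} {r : ℝ≥0∞}

/-- The canonical map from the algebraic free product to `ODef n r`. -/
def algToODef (n : ℕ) (r : ℝ≥0∞) :
    AlgFreeProduct (fun _ : Fin n => Hol (disk r) ℂ) →ₐ[ℂ] ODef n r where
  toFun a := toODef n r (constHol puncturedPlane
    (a : UniformSpace.Completion (AlgFreeProduct (fun _ : Fin n => Hol (disk r) ℂ))))
  map_one' := by
    rw [UniformSpace.Completion.coe_one]; exact map_one (toODef n r)
  map_mul' a b := by
    rw [UniformSpace.Completion.coe_mul, ← map_mul]; rfl
  map_zero' := by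
    rw [UniformSpace.Completion.coe_zero]; exact map_zero (toODef n r)
  map_add' a b := by
    rw [UniformSpace.Completion.coe_add, ← map_add]; rfl
  commutes' c := rfl

theorem continuous_algToODef : Continuous (algToODef n r) :=
  (isOpenQuotientMap_toODef n r).continuous.comp
    ((continuous_constHol _ _).comp (UniformSpace.Completion.continuous_coe _))

/-- Restriction to `K` makes `ψ` a continuous map to the normed space `C(K, ℂ)`, so its norm is
dominated by finitely many defining seminorms. -/
theorem exists_norm_le_on_compact (ψ : ODef n r →L[HolCx] HolCx) {K : Set puncturedPlane}
    (hK : IsCompact K) : ∃ (s : Finset (FreeSeminorm fun _ : Fin n => Hol (disk r) ℂ)) (C : ℝ),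
      0 ≤ C ∧ ∀ a, ∀ z ∈ K, ‖evalHol z (ψ (algToODef n r a))‖ ≤
        C * (s.sup (freeSeminorms fun _ : Fin n => Hol (disk r) ℂ)) a := by
  have : CompactSpace K := isCompact_iff_compactSpace.1 hK
  let ρ : HolCx →L[ℂ] C(K, ℂ) :=
    { toFun := fun f => f.1.restrict K
      map_add' := fun _ _ => rfl
      map_smul' := fun _ _ => rfl
      cont := (ContinuousMap.continuous_restrict K).comp continuous_subtype_val }
  let L : AlgFreeProduct (fun _ : Fin n => Hol (disk r) ℂ) →ₗ[ℂ] C(K, ℂ) :=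
    (ρ.comp (ψ.restrictScalars ℂ)).toLinearMap ∘ₗ (algToODef n r).toLinearMap
  have hL : Continuous L := ρ.continuous.comp (ψ.continuous.comp continuous_algToODef)
  obtain ⟨s, C, -, hC⟩ := Seminorm.bound_of_continuous
    (withSeminorms_freeSeminorms fun _ : Fin n => Hol (disk r) ℂ)
    ((normSeminorm ℂ C(K, ℂ)).comp L) hL.norm
  refine ⟨s, C, C.2, fun a z hz => ?_⟩
  exact ((L a).norm_coe_le_norm ⟨z, hz⟩).trans (hC a)

/-- The point is that `B` and `C` do not depend on `k`: only finitely many submultiplicative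
seminorms are involved. -/
theorem exists_pow_bound (ψ : ODef n r →L[HolCx] HolCx) {K : Set puncturedPlane}
    (hK : IsCompact K) (a b : AlgFreeProduct fun _ : Fin n => Hol (disk r) ℂ) :
    ∃ (B C : ℝ), 0 < B ∧ ∀ k, ∀ z ∈ K,
      ‖evalHol z (ψ (algToODef n r (a ^ k * b ^ k)))‖ ≤ C * B ^ (2 * k) ∧
      ‖evalHol z (ψ (algToODef n r (b ^ k * a ^ k)))‖ ≤ C * B ^ (2 * k) := by
  obtain ⟨s, C, hC0, hC⟩ := exists_norm_le_on_compact ψ hK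
  obtain ⟨B, hB0, hB⟩ : ∃ B : ℝ, 0 < B ∧ ∀ p ∈ s, p.1 1 ≤ B ∧ p.1 a ≤ B ∧ p.1 b ≤ B := by
    refine ⟨∑ p ∈ s, (p.1 1 + p.1 a + p.1 b) + 1, ?_, fun p hp => ?_⟩
    · have : 0 ≤ ∑ p ∈ s, (p.1 1 + p.1 a + p.1 b) := Finset.sum_nonneg fun p _ => by positivity
      positivity
    · have := Finset.single_le_sum (f := fun p : FreeSeminorm fun _ : Fin n => Hol (disk r) ℂ =>
        p.1 1 + p.1 a + p.1 b) (fun p _ => by positivity) hp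
      have h1 := apply_nonneg p.1 1
      have ha := apply_nonneg p.1 a
      have hb := apply_nonneg p.1 b
      dsimp only at this
      refine ⟨?_, ?_, ?_⟩ <;> linarith
  have key : ∀ k (x y : AlgFreeProduct fun _ : Fin n => Hol (disk r) ℂ),
      (∀ p ∈ s, p.1 x ≤ B ∧ p.1 y ≤ B) →
        (s.sup (freeSeminorms fun _ : Fin n => Hol (disk r) ℂ)) (x ^ k * y ^ k) ≤
          B ^ 2 * B ^ (2 * k) := by
    intro k x y h
    refine Seminorm.finset_sup_apply_le (by positivity) fun p hp => (p.2.1 _ _).trans ?_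
    have hx := seminorm_pow_le p.2.1 (hB p hp).1 (h p hp).1 k
    have hy := seminorm_pow_le p.2.1 (hB p hp).1 (h p hp).2 k
    refine (mul_le_mul hx hy (apply_nonneg _ _) (by positivity)).trans (le_of_eq ?_)
    ring
  refine ⟨B, C * B ^ 2, hB0, fun k z hz => ⟨?_, ?_⟩⟩
  · refine (hC _ z hz).trans ?_
    rw [mul_assoc]
    exact mul_le_mul_of_nonneg_left (key k a b fun p hp => (hB p hp).2) hC0
  · refine (hC _ z hz).trans ?_
    rw [mul_assoc]
    exact mul_le_mul_of_nonneg_left (key k b a fun p hp => (hB p hp).2.symm) hC0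

theorem algToODef_q_commute (i j : Fin n) (hij : i < j) :
    let x := algIncl (fun _ : Fin n => Hol (disk r) ℂ) i (coord (disk r))
    let y := algIncl (fun _ : Fin n => Hol (disk r) ℂ) j (coord (disk r))
    algToODef n r x * algToODef n r y = algebraMap HolCx (ODef n r) (coord puncturedPlane) *
      (algToODef n r y * algToODef n r x) := by
  intro x y
  have h : toODef n r (relator n r i j) = 0 :=
    Ideal.Quotient.eq_zero_iff_mem.2 (subset_closedIdealSpan _ ⟨i, j, hij, rfl⟩)
  rw [relator, map_sub, sub_eq_zero, map_mul] at h
  have h1 : constHol puncturedPlane (zeta n r i * zeta n r j) =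
    constHol puncturedPlane (zeta n r i) * constHol puncturedPlane (zeta n r j) := rfl
  have h2 : constHol puncturedPlane (zeta n r j * zeta n r i) =
    constHol puncturedPlane (zeta n r j) * constHol puncturedPlane (zeta n r i) := rfl
  rw [h1, h2, map_mul, map_mul] at h
  exact h

/-- A morphism to `𝒪(ℂ^×)` is super-exponentially small at `1` on the products
`ζ_i ^ k * ζ_j ^ k`. -/
theorem exists_norm_apply_onePoint_le (ψ : ODef n r →L[HolCx] HolCx) (i j : Fin n) (hij : i < j) :
    let x := algIncl (fun _ : Fin n => Hol (disk r) ℂ) i (coord (disk r))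
    let y := algIncl (fun _ : Fin n => Hol (disk r) ℂ) j (coord (disk r))
    ∃ B C : ℝ, 0 < B ∧ ∀ k : ℕ,
      ‖evalHol onePoint (ψ (algToODef n r (x ^ (2 * k) * y ^ (2 * k))))‖ ≤
        C * B ^ (4 * k) / 2 ^ (2 * k ^ 2) := by
  intro x y
  let K : Set puncturedPlane := (↑) ⁻¹' {z : ℂ | 1 / 2 ≤ ‖z‖ ∧ ‖z‖ ≤ 2}
  have hK : IsCompact K := by
    have hc : IsCompact {z : ℂ | 1 / 2 ≤ ‖z‖ ∧ ‖z‖ ≤ 2} := by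
      refine (isCompact_closedBall (0 : ℂ) 2).of_isClosed_subset
        ((isClosed_le continuous_const continuous_norm).inter
          (isClosed_le continuous_norm continuous_const)) fun z hz => ?_
      exact mem_closedBall_zero_iff.2 hz.2
    refine puncturedPlane.isOpen.isOpenEmbedding_subtypeVal.isInducing.isCompact_preimage' hc ?_
    rintro z ⟨hz, -⟩
    refine ⟨⟨z, ?_⟩, rfl⟩
    rintro rfl
    norm_num at hz
  obtain ⟨B, C, hB, hBC⟩ := exists_pow_bound ψ hK x y
  refine ⟨B, C, hB, fun k => ?_⟩
  let Z := algebraMap HolCx (ODef n r) (coord puncturedPlane)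
  have hZ : ∀ p, Commute Z p := fun p => Algebra.commutes _ p
  let h := ψ (algToODef n r (x ^ (2 * k) * y ^ (2 * k)))
  let g := ψ (algToODef n r (y ^ (2 * k) * x ^ (2 * k)))
  -- Even powers `2 * k` make the total exponent `4k²` even, as the balancing in `norm_apply_one_le`
  -- with `m = 2 * k ^ 2` requires.
  have hgh : ∀ z : puncturedPlane, evalHol z h = (z : ℂ) ^ (2 * (2 * k ^ 2)) * evalHol z g := by
    intro z
    have e : algToODef n r (x ^ (2 * k) * y ^ (2 * k)) =
        (coord puncturedPlane) ^ (2 * (2 * k ^ 2)) •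
          algToODef n r (y ^ (2 * k) * x ^ (2 * k)) := by
      simp only [map_mul, map_pow, Algebra.smul_def]
      rw [pow_mul_pow_of_q_commuting (hZ _) (hZ _) (algToODef_q_commute i j hij)]
      congr 2
      ring
    have e' : h = (coord puncturedPlane) ^ (2 * (2 * k ^ 2)) • g := by
      simp only [h, g]
      rw [e, map_smul]
    rw [e', smul_eq_mul, map_mul, map_pow]
    rfl
  have hmem : ∀ z : ℂ, 1 / 2 ≤ ‖z‖ → ‖z‖ ≤ 2 → ∃ w : puncturedPlane, w ∈ K ∧ (w : ℂ) = z := by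
    intro z h1 h2
    refine ⟨⟨z, ?_⟩, ⟨h1, h2⟩, rfl⟩
    rintro rfl
    norm_num at h1
  have hg : DifferentiableOn ℂ (extendZero fun z => evalHol z g) {z | z ≠ 0} :=
    IsHolomorphic.differentiableOn g.2 (ContinuousLinearMap.id ℂ ℂ)
  have hext : ∀ z : puncturedPlane, extendZero (fun z => evalHol z g) z = evalHol z g :=
    extendZero_apply _
  have hfin := norm_apply_one_le hg (C := C * B ^ (4 * k)) (2 * k ^ 2) (fun z hz => ?_)
    fun z hz => ?_
  · have h1 := hgh onePoint
    have h2 := hext onePoint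
    have h3 : ((onePoint : puncturedPlane) : ℂ) = 1 := rfl
    rw [h3] at h1 h2
    rw [one_pow, one_mul] at h1
    change ‖evalHol onePoint h‖ ≤ _
    rwa [h1, ← h2]
  · obtain ⟨w, hw, rfl⟩ := hmem z hz.ge (by rw [hz]; norm_num)
    rw [hext]
    refine (hBC (2 * k) w hw).2.trans (le_of_eq ?_)
    ring
  · obtain ⟨w, hw, rfl⟩ := hmem z (by rw [hz]; norm_num) hz.le
    rw [hext, ← hgh]
    refine (hBC (2 * k) w hw).1.trans (le_of_eq ?_)
    ring

theorem oDefCharacter_algToODef (w : disk r) (i : Fin n) :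
    oDefCharacter w
      (algToODef n r (algIncl (fun _ : Fin n => Hol (disk r) ℂ) i (coord (disk r)))) = w :=
  diagCharacter_zeta w i

theorem not_isTopProjective_oDef (hn : 2 ≤ n) (hr : 0 < r) : ¬ IsTopProjective HolCx (ODef n r) := by
  intro hP
  -- The point must be nonzero so that the character takes the value `q ^ (4 * k) > 0`; taking `q`
  -- finite covers `r = ∞`.
  obtain ⟨q, hq0, hqr⟩ := ENNReal.lt_iff_exists_nnreal_btwn.1 hr
  have hq0 : 0 < q := by exact_mod_cast hq0
  let w : disk r := ⟨((q : ℝ) : ℂ), by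
    change ENNReal.ofReal ‖((q : ℝ) : ℂ)‖ < r
    simpa using hqr⟩
  -- The test epimorphism is evaluation at `1`, from `𝒪(ℂ^×)` to its fibre there.
  let _ : Module HolCx ℂ := Module.compHom ℂ (evalHol onePoint : HolCx →ₐ[ℂ] ℂ).toRingHom
  have hsmul : ∀ (f : HolCx) (c : ℂ), f • c = evalHol onePoint f * c := fun _ _ => rfl
  have : IsScalarTower ℂ HolCx ℂ := ⟨fun c f y => by
    rw [hsmul, hsmul, map_smul, smul_eq_mul, smul_eq_mul, mul_assoc]⟩
  have hY : IsFrechetModule HolCx ℂ :=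
    { toIsFrechetSpace := isFrechetSpace_of_uniformSpace
      continuous_action :=
        ((continuous_evalHol onePoint).comp continuous_fst).mul continuous_snd }
  let σ : HolCx →L[HolCx] ℂ :=
    { toFun := evalHol onePoint
      map_add' := map_add _
      map_smul' := map_mul _
      cont := continuous_evalHol onePoint }
  let κ : ℂ →L[ℂ] HolCx :=
    { toFun := constHol puncturedPlane
      map_add' := fun _ _ => rfl
      map_smul' := fun _ _ => rfl
      cont := continuous_constHol _ _ }
  let φ : ODef n r →L[HolCx] ℂ :=
    { toFun := oDefCharacter w
      map_add' := map_add _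
      map_smul' := oDefCharacter_smul w
      cont := continuous_oDefCharacter w }
  obtain ⟨ψ, hψ⟩ := hP HolCx ℂ isFrechetModule_holCx hY σ ⟨κ, fun _ => rfl⟩ φ
  let i : Fin n := ⟨0, by omega⟩
  let j : Fin n := ⟨1, by omega⟩
  obtain ⟨B, C, hB, h⟩ := exists_norm_apply_onePoint_le ψ i j (by simp [i, j])
  refine not_forall_pow_le (q := q) (by exact_mod_cast hq0) hB (C := C) fun k => ?_
  refine le_trans (le_of_eq ?_) (h k)
  have h1 := DFunLike.congr_fun hψ (algToODef n r
    (algIncl (fun _ : Fin n => Hol (disk r) ℂ) i (coord (disk r)) ^ (2 * k) *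
      algIncl (fun _ : Fin n => Hol (disk r) ℂ) j (coord (disk r)) ^ (2 * k)))
  have h2 : evalHol onePoint (ψ (algToODef n r
    (algIncl (fun _ : Fin n => Hol (disk r) ℂ) i (coord (disk r)) ^ (2 * k) *
      algIncl (fun _ : Fin n => Hol (disk r) ℂ) j (coord (disk r)) ^ (2 * k)))) = _ := h1
  rw [h2]
  change _ = ‖oDefCharacter w _‖
  rw [map_mul, map_mul, map_pow, map_pow, map_pow, map_pow, oDefCharacter_algToODef,
    oDefCharacter_algToODef, ← pow_add, norm_pow]
  have h3 : ‖(w : ℂ)‖ = q := by simp [w]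
  rw [h3]
  congr 1
  ring

end Projectivity

end HolDef

theorem theorem8p13 (n : ℕ) (hn : 2 ≤ n) (r : ENNReal) (hr : 0 < r) :
    HolDef.IsFrechetModule HolDef.HolCx (HolDef.ODef n r) ∧
      ¬ HolDef.IsTopProjective HolDef.HolCx (HolDef.ODef n r) ∧
      ¬ HolDef.IsTopFree HolDef.HolCx (HolDef.ODef n r) := by
  have : NeZero n := ⟨by omega⟩
  have hM := HolDef.isFrechetModule_oDef n r
  have hP := HolDef.not_isTopProjective_oDef hn hr
  exact ⟨hM, hP, fun hF => hP (hF.isTopProjective hM)⟩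

end
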